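/- Let $N$ be a finite set of agents and let $D=\{0,1\}$ be the set of alternatives. In a ballot list $B=(B_a)_{a\in N}$, each agent $a$ casts a ranked ballot $B_a = B_a(0)\succ\dots\succ B_a(k_a-1)\succ B_a(k_a)$, where $k_a\ge 0$, the entries $B_a(0),\dots,B_a(k_a-1)$ are pairwise distinct agents in $N\setminus\{a\}$ (delegations), and $B_a(k_a)\in D$ (a direct vote). The delegation graph has vertex set $N\cup D\cup\{r\}$ (disjoint union), an edge $a\to B_a(i)$ for each $a\in N$ and $0\le i\le k_a$, and an edge $d\to r$ for each $d\in D$. A certificate is a vector $c=(c_a)_{a\in N}$ of integers with $0\le c_a\le k_a$; it is consistent if the edges $\{(a,B_a(c_a)) : a\in N\}\cup\{(d,r): d\in D\}$ form a directed spanning tree of the delegation graph with sink $r$. A consistent certificate induces the concrete votes $X\in D^N$ in which $X_a$ is the alternative that lies on the path from $a$ to $r$ in this tree. Let $\mathrm{MinMax}(B)$ (respectively $\mathrm{MinSum}(B)$) be the set of all concrete votes induced by consistent certificates that minimise $\max_{a\in N}c_a$ (respectively $\sum_{a\in N}c_a$) among all consistent certificates. For $p\in\{0,1\}$, let the biased rule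 $\mathrm{MinMax}^p$ (respectively $\mathrm{MinSum}^p$) select the elements $X$ of $\mathrm{MinMax}(B)$ (respectively $\mathrm{MinSum}(B)$) with the highest possible number of agents $a$ such that $X_a=p$. For $X,Y\in\{0,1\}^N$ write $X\le Y$ if $X_a\le Y_a$ for all $a\in N$. Then, for every ballot list $B$, the biased rules are resolute, that is, each of $\mathrm{MinMax}^0(B)$, $\mathrm{MinMax}^1(B)$, $\mathrm{MinSum}^0(B)$, $\mathrm{MinSum}^1(B)$ consists of exactly one collection of concrete votes, and, identifying each of them with its only element, $$\mathrm{MinMax}^0(B)\le X\le \mathrm{MinMax}^1(B)\quad\text{for all } X\in \mathrm{MinMax}(B),$$ $$\mathrm{MinSum}^0(B)\le X'\le \mathrm{MinSum}^1(B)\quad\text{for all } X'\in \mathrm{MinSum}(B).$$ In particular, $\mathrm{MinMax}^0(B)$ and $\mathrm{MinMax}^1(B)$ are the pointwise least and greatest elements of $\mathrm{MinMax}(B)$, and $\mathrm{MinSum}^0(B)$ and $\mathrm{MinSum}^1(B)$ are those of $\mathrm{MinSum}(B)$. -/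

import Mathlib

namespace LiquidDemocracy

/-- A ranked ballot of agent `a`: `deleg 0 ≻ … ≻ deleg (size - 1) ≻ direct`, where the delegates
are pairwise distinct agents other than `a`, and `direct` is a backup direct vote. -/
structure Ballot (N D : Type*) (a : N) where
  size : ℕ
  deleg : Fin size → N
  deleg_ne : ∀ i, deleg i ≠ a
  deleg_injective : Function.Injective deleg
  direct : D

/-- A ballot list: one ballot for every agent. -/
abbrev Ballots (N D : Type*) := ∀ a : N, Ballot N D a

/-- Vertices of the delegation graph: the agents, the alternatives and the root. -/
inductive Vertex (N D : Type*) where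
  | agent (a : N)
  | alt (d : D)
  | root

variable {N D : Type*}

/-- The entry at position `i` of the ballot of `a`, as a vertex of the delegation graph;
the last position `i = size` holds the direct vote. -/
def Ballot.entry {a : N} (b : Ballot N D a) (i : Fin (b.size + 1)) : Vertex N D :=
  if h : (i : ℕ) < b.size then .agent (b.deleg ⟨i, h⟩) else .alt b.direct

/-- The edges of the delegation graph: `a → B_a(i)` for all agents `a` and positions
`0 ≤ i ≤ k_a`, and `d → r` for all alternatives `d`. -/
def delegationGraph (B : Ballots N D) : Set (Vertex N D × Vertex N D) :=
  {e | ∃ (a : N) (i : Fin ((B a).size + 1)), e = (.agent a, (B a).entry i)} ∪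
    {e | ∃ d : D, e = (.alt d, .root)}

/-- `v` can be reached from `u` along directed edges in `T` (in zero or more steps). -/
def Reaches {V : Type*} (T : Set (V × V)) (u v : V) : Prop :=
  Relation.ReflTransGen (fun x y => (x, y) ∈ T) u v

/-- `T` is an `r`-arborescence of the directed graph with edge set `E`: a directed spanning tree
whose sink is `r`. -/
structure IsArborescence {V : Type*} (E : Set (V × V)) (r : V) (T : Set (V × V)) : Prop where
  subset : T ⊆ E
  sink : ∀ v, (r, v) ∉ T
  out_unique : ∀ u, u ≠ r → ∃! v, (u, v) ∈ T
  reaches : ∀ u, Reaches T u r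

/-- A certificate selects a position `0 ≤ c_a ≤ k_a` in the ballot of every agent `a`. -/
abbrev Certificate (B : Ballots N D) := ∀ a : N, Fin ((B a).size + 1)

/-- The set of edges selected by a certificate. -/
def certEdges (B : Ballots N D) (c : Certificate B) : Set (Vertex N D × Vertex N D) :=
  {e | ∃ a : N, e = (.agent a, (B a).entry (c a))} ∪ {e | ∃ d : D, e = (.alt d, .root)}

/-- A certificate is consistent if its edges form an arborescence of the delegation graph. -/
def Consistent (B : Ballots N D) (c : Certificate B) : Prop :=
  IsArborescence (delegationGraph B) .root (certEdges B c)

/-- The concrete votes `X` are those induced by `c`: for every agent `a`, the alternative `X a`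
lies on the path from `a` to the root. (Every vertex but the root has exactly one outgoing selected
edge, so the vertices on this path are those that can be reached from `a`.) -/
def Induces (B : Ballots N D) (c : Certificate B) (X : N → D) : Prop :=
  ∀ a : N, Reaches (certEdges B c) (.agent a) (.alt (X a))

variable [Fintype N]

/-- The sum of the positions used by a certificate. -/
def sumCost (B : Ballots N D) (c : Certificate B) : ℕ := ∑ a, (c a : ℕ)

/-- The maximum of the positions used by a certificate. -/
def maxCost (B : Ballots N D) (c : Certificate B) : ℕ := Finset.univ.sup fun a => (c a : ℕ)

/-- A consistent certificate of minimum sum. -/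
def IsMinSumCertificate (B : Ballots N D) (c : Certificate B) : Prop :=
  Consistent B c ∧ ∀ c' : Certificate B, Consistent B c' → sumCost B c ≤ sumCost B c'

/-- A consistent certificate of minimum maximum. -/
def IsMinMaxCertificate (B : Ballots N D) (c : Certificate B) : Prop :=
  Consistent B c ∧ ∀ c' : Certificate B, Consistent B c' → maxCost B c ≤ maxCost B c'

/-- The set of possible outcomes (collections of concrete votes) of MinSum. -/
def MinSum (B : Ballots N D) : Set (N → D) :=
  {X | ∃ c : Certificate B, IsMinSumCertificate B c ∧ Induces B c X}

/-- The set of possible outcomes (collections of concrete votes) of MinMax. -/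
def MinMax (B : Ballots N D) : Set (N → D) :=
  {X | ∃ c : Certificate B, IsMinMaxCertificate B c ∧ Induces B c X}

/-- The number of agents who vote `p` in `X`. -/
def voteCount [DecidableEq D] (p : D) (X : N → D) : ℕ := (Finset.univ.filter fun a => X a = p).card

/-- Tie-breaking in favour of `p`: the outcomes in `S` with the highest number of votes for `p`. -/
def favouring [DecidableEq D] (p : D) (S : Set (N → D)) : Set (N → D) :=
  {X | X ∈ S ∧ ∀ Y ∈ S, voteCount p Y ≤ voteCount p X}

/-- The biased rule `MinSum^p`, as a set of outcomes. -/
def MinSumBiased [DecidableEq D] (p : D) (B : Ballots N D) : Set (N → D) := favouring p (MinSum B)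

/-- The biased rule `MinMax^p`, as a set of outcomes. -/
def MinMaxBiased [DecidableEq D] (p : D) (B : Ballots N D) : Set (N → D) := favouring p (MinMax B)

end LiquidDemocracy

namespace LiquidDemocracy

section Paths

variable {N D : Type*} {B : Ballots N D} {c d : Certificate B}

/-! Take two optimal certificates `c`, `d`. Let the agents voting `p` under `c` keep `c` and let the
others follow `d`. The result is consistent, and everyone voting `p` under `c` or `d` now votes `p`
(`exists_induces_merge`). The complementary merge is consistent too, so exchanging positions leaves
the first merge optimal (`MergeStable`). Hence an optimal outcome with the most votes for `p`
contains the `p`-voters of every optimal outcome; with two alternatives this makes it unique and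
extremal. -/

theorem Reaches.head_edge {V : Type*} {T : Set (V × V)} {u v w : V} (h : (u, v) ∈ T)
    (hvw : Reaches T v w) : Reaches T u w :=
  Relation.ReflTransGen.head h hvw

theorem agent_mem_certEdges {a : N} {v : Vertex N D} :
    (Vertex.agent a, v) ∈ certEdges B c ↔ v = (B a).entry (c a) := by
  constructor
  · rintro (⟨b, hb⟩ | ⟨d, hd⟩)
    · simp only [Prod.mk.injEq, Vertex.agent.injEq] at hb
      obtain ⟨rfl, rfl⟩ := hb
      rfl
    · simp at hd
  · rintro rfl
    exact Or.inl ⟨a, rfl⟩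

theorem alt_mem_certEdges {x : D} {v : Vertex N D} :
    (Vertex.alt x, v) ∈ certEdges B c ↔ v = .root := by
  simp [certEdges]

theorem root_notMem_certEdges {v : Vertex N D} : (Vertex.root, v) ∉ certEdges B c := by
  simp [certEdges]

theorem certEdges_functional {u v w : Vertex N D} (hv : (u, v) ∈ certEdges B c)
    (hw : (u, w) ∈ certEdges B c) : v = w := by
  cases u with
  | agent a => rw [agent_mem_certEdges] at hv hw; rw [hv, hw]
  | alt x => rw [alt_mem_certEdges] at hv hw; rw [hv, hw]
  | root => exact absurd hv root_notMem_certEdges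

theorem not_reaches_root_alt {x : D} : ¬ Reaches (certEdges B c) .root (.alt x) := by
  intro h
  rcases Relation.ReflTransGen.cases_head h with h | ⟨v, hv, -⟩
  · cases h
  · exact root_notMem_certEdges hv

theorem alt_reaches_alt {x y : D} (h : Reaches (certEdges B c) (.alt x) (.alt y)) : x = y := by
  rcases Relation.ReflTransGen.cases_head h with h | ⟨v, hv, h⟩
  · simpa using h
  · obtain rfl := alt_mem_certEdges.1 hv
    exact absurd h not_reaches_root_alt

theorem reaches_alt_unique {v : Vertex N D} {x y : D} (hx : Reaches (certEdges B c) v (.alt x))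
    (hy : Reaches (certEdges B c) v (.alt y)) : x = y := by
  induction hx using Relation.ReflTransGen.head_induction_on with
  | refl => exact alt_reaches_alt hy
  | @head u w hu hw ih =>
    rcases Relation.ReflTransGen.cases_head hy with rfl | ⟨w', hw', h⟩
    · obtain rfl := alt_mem_certEdges.1 hu
      exact absurd hw not_reaches_root_alt
    · exact ih (certEdges_functional hu hw' ▸ h)

theorem alt_reaches_root (x : D) : Reaches (certEdges B c) (.alt x) .root :=
  Relation.ReflTransGen.single (alt_mem_certEdges.2 rfl)

theorem certEdges_subset : certEdges B c ⊆ delegationGraph B := by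
  rintro e (⟨a, rfl⟩ | ⟨x, rfl⟩)
  · exact Or.inl ⟨a, _, rfl⟩
  · exact Or.inr ⟨x, rfl⟩

/-- Selected edges are functional by construction, so reachability of the root is the only real
condition. Merges thus need only be checked for reaching alternatives. -/
theorem Induces.consistent {X : N → D} (h : Induces B c X) : Consistent B c where
  subset := certEdges_subset
  sink _ := root_notMem_certEdges
  out_unique u hu := by
    cases u with
    | agent a => exact ⟨_, agent_mem_certEdges.2 rfl, fun v hv => agent_mem_certEdges.1 hv⟩
    | alt x => exact ⟨_, alt_mem_certEdges.2 rfl, fun v hv => alt_mem_certEdges.1 hv⟩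
    | root => exact absurd rfl hu
  reaches u := by
    cases u with
    | agent a => exact (h a).trans (alt_reaches_root _)
    | alt x => exact alt_reaches_root x
    | root => exact Relation.ReflTransGen.refl

theorem Consistent.exists_induces (h : Consistent B c) : ∃ X, Induces B c X := by
  have key : ∀ v, v ≠ .root → ∃ x : D, Reaches (certEdges B c) v (.alt x) := by
    intro v
    induction h.reaches v using Relation.ReflTransGen.head_induction_on with
    | refl => exact fun hv => absurd rfl hv
    | @head u w hu hw ih =>
      intro _
      cases u with
      | agent a =>
        obtain ⟨x, hx⟩ := ih (by
          rw [agent_mem_certEdges.1 hu]; unfold Ballot.entry; split <;> simp)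
        exact ⟨x, Reaches.head_edge hu hx⟩
      | alt x => exact ⟨x, Relation.ReflTransGen.refl⟩
      | root => exact absurd hu root_notMem_certEdges
  choose X hX using fun a : N => key (.agent a) (by simp)
  exact ⟨X, hX⟩

theorem induces_last (B : Ballots N D) :
    Induces B (fun a => Fin.last (B a).size) fun a => (B a).direct := fun a =>
  Relation.ReflTransGen.single (agent_mem_certEdges.2 (by simp [Ballot.entry]))

open Classical in
/-- The certificate that agrees with `c` on `s` and with `d` outside of `s`. -/
noncomputable def merge (c d : Certificate B) (s : Set N) : Certificate B :=
  fun a => if a ∈ s then c a else d a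

variable {X Y : N → D} {P : Set D}

theorem merge_of_mem {s : Set N} {a : N} (h : a ∈ s) : merge c d s a = c a := if_pos h

theorem merge_of_notMem {s : Set N} {a : N} (h : a ∉ s) : merge c d s a = d a := if_neg h

theorem merge_compl (c d : Certificate B) (s : Set N) : merge c d sᶜ = merge d c s := by
  funext a
  by_cases ha : a ∈ s
  · rw [merge_of_mem ha, merge_of_notMem (by simpa using ha)]
  · rw [merge_of_notMem ha, merge_of_mem (by simpa using ha)]

/-- All agents on a `c`-path to `x` have the induced vote `x ∈ P`, so the merge keeps the whole
path. -/
theorem reaches_merge_left (hX : Induces B c X) {v : Vertex N D} {x : D} (hx : x ∈ P)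
    (h : Reaches (certEdges B c) v (.alt x)) :
    Reaches (certEdges B (merge c d {a | X a ∈ P})) v (.alt x) := by
  induction h using Relation.ReflTransGen.head_induction_on with
  | refl => exact Relation.ReflTransGen.refl
  | @head u w hu hw ih =>
    refine Reaches.head_edge ?_ ih
    cases u with
    | agent a =>
      have ha : X a ∈ P := by rwa [reaches_alt_unique (hX a) (Reaches.head_edge hu hw)]
      rw [agent_mem_certEdges] at hu ⊢
      rwa [merge_of_mem (s := {a | X a ∈ P}) ha]
    | alt y => exact alt_mem_certEdges.2 (alt_mem_certEdges.1 hu)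
    | root => exact absurd hu root_notMem_certEdges

/-- Follow the `d`-path until it meets an agent with `X a ∈ P`, then switch to that agent's
`c`-path; if there is none, the `d`-path survives. -/
theorem reaches_merge_right (hX : Induces B c X) {v : Vertex N D} {x : D}
    (h : Reaches (certEdges B d) v (.alt x)) :
    ∃ y, (y = x ∨ y ∈ P) ∧ Reaches (certEdges B (merge c d {a | X a ∈ P})) v (.alt y) := by
  induction h using Relation.ReflTransGen.head_induction_on with
  | refl => exact ⟨x, Or.inl rfl, Relation.ReflTransGen.refl⟩
  | @head u w hu hw ih =>
    obtain ⟨y, hy, hwy⟩ := ih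
    cases u with
    | agent a =>
      by_cases ha : X a ∈ P
      · exact ⟨X a, Or.inr ha, reaches_merge_left hX ha (hX a)⟩
      · refine ⟨y, hy, Reaches.head_edge ?_ hwy⟩
        rw [agent_mem_certEdges] at hu ⊢
        rwa [merge_of_notMem (s := {a | X a ∈ P}) ha]
    | alt z => exact ⟨y, hy, Reaches.head_edge (alt_mem_certEdges.2 (alt_mem_certEdges.1 hu)) hwy⟩
    | root => exact absurd hu root_notMem_certEdges

theorem exists_induces_merge (hX : Induces B c X) (hY : Induces B d Y) (P : Set D) :
    ∃ Z, Induces B (merge c d {a | X a ∈ P}) Z ∧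
      (∀ a, X a ∈ P → Z a = X a) ∧ ∀ a, Z a = Y a ∨ Z a ∈ P := by
  choose Z hZ hZr using fun a => reaches_merge_right (P := P) hX (hY a)
  exact ⟨Z, hZr, fun a ha => reaches_alt_unique (hZr a) (reaches_merge_left hX ha (hX a)), hZ⟩

end Paths

section Optimisation

variable {N D : Type*} [Fintype N] {B : Ballots N D}

/-- The outcomes of the consistent certificates that minimise `cost`. -/
def minOutcomes (B : Ballots N D) (cost : Certificate B → ℕ) : Set (N → D) :=
  {X | ∃ c : Certificate B,
    (Consistent B c ∧ ∀ c' : Certificate B, Consistent B c' → cost c ≤ cost c') ∧ Induces B c X}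

/-- Two certificates of equal cost cannot be merged into a more expensive one, unless the
complementary merge is cheaper. -/
def MergeStable (cost : Certificate B → ℕ) : Prop :=
  ∀ c d s, cost c = cost d → cost (merge c d s) ≤ cost c ∨ cost (merge d c s) < cost c

theorem mergeStable_sumCost : MergeStable (sumCost B) := by
  intro c d s h
  have key : sumCost B (merge c d s) + sumCost B (merge d c s) = sumCost B c + sumCost B d := by
    simp only [sumCost, ← Finset.sum_add_distrib]
    refine Finset.sum_congr rfl fun a _ => ?_
    by_cases ha : a ∈ s
    · rw [merge_of_mem ha, merge_of_mem ha]
    · rw [merge_of_notMem ha, merge_of_notMem ha, add_comm]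
  omega

theorem mergeStable_maxCost : MergeStable (maxCost B) := by
  intro c d s h
  -- Every position is bounded by the common maximum, so no merge can cost more.
  refine Or.inl (Finset.sup_le fun a _ => ?_)
  by_cases ha : a ∈ s
  · rw [merge_of_mem ha]
    exact Finset.le_sup (f := fun a => (c a : ℕ)) (Finset.mem_univ a)
  · rw [merge_of_notMem ha, h]
    exact Finset.le_sup (f := fun a => (d a : ℕ)) (Finset.mem_univ a)

theorem minOutcomes_nonempty (cost : Certificate B → ℕ) : (minOutcomes B cost).Nonempty := by
  obtain ⟨c, hc, hmin⟩ := Set.exists_min_image {c | Consistent B c} cost (Set.toFinite _)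
    ⟨_, (induces_last B).consistent⟩
  obtain ⟨X, hX⟩ := Consistent.exists_induces hc
  exact ⟨X, c, ⟨hc, hmin⟩, hX⟩

theorem MergeStable.exists_minOutcomes {cost : Certificate B → ℕ} (hcost : MergeStable cost)
    (p : D) {X Y : N → D} (hX : X ∈ minOutcomes B cost) (hY : Y ∈ minOutcomes B cost) :
    ∃ Z ∈ minOutcomes B cost, ∀ a, X a = p ∨ Y a = p → Z a = p := by
  obtain ⟨c, ⟨hc, hcmin⟩, hcX⟩ := hX
  obtain ⟨d, ⟨hd, hdmin⟩, hdY⟩ := hY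
  obtain ⟨Z, hZ, hZX, hZY⟩ := exists_induces_merge hcX hdY {p}
  -- Needed only for consistency: this is the complementary merge, which optimality then prevents
  -- from being cheaper than `c`.
  obtain ⟨W, hW, -⟩ := exists_induces_merge hcX hdY {p}ᶜ
  have hW' : Consistent B (merge d c {a | X a ∈ ({p} : Set D)}) := by
    rw [← merge_compl]
    exact hW.consistent
  have hle : cost (merge c d {a | X a ∈ ({p} : Set D)}) ≤ cost c :=
    (hcost c d _ (le_antisymm (hcmin d hd) (hdmin c hc))).resolve_right (hcmin _ hW').not_gt
  refine ⟨Z, ⟨_, ⟨hZ.consistent, fun c' hc' => hle.trans (hcmin c' hc')⟩, hZ⟩, ?_⟩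
  rintro a (ha | ha)
  · rw [hZX a ha, ha]
  · rcases hZY a with h | h
    · rw [h, ha]
    · exact h

theorem voteCount_lt_voteCount [DecidableEq D] {p : D} {X Z : N → D}
    (h : ∀ a, X a = p → Z a = p) {a : N} (hX : X a ≠ p) (hZ : Z a = p) :
    voteCount p X < voteCount p Z := by
  refine Finset.card_lt_card (Finset.ssubset_iff_of_subset ?_ |>.2 ⟨a, ?_, ?_⟩)
  · intro b
    simpa using h b
  · simpa using hZ
  · simpa using hX

end Optimisation

theorem exists_favouring_eq_singleton {N : Type*} [Fintype N] {p : Fin 2}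
    {S : Set (N → Fin 2)} (hne : S.Nonempty)
    (hS : ∀ X ∈ S, ∀ Y ∈ S, ∃ Z ∈ S, ∀ a, X a = p ∨ Y a = p → Z a = p) :
    ∃ U ∈ S, favouring p S = {U} ∧ ∀ Y ∈ S, ∀ a, Y a = p → U a = p := by
  have top : ∀ U ∈ favouring p S, ∀ Y ∈ S, ∀ a, Y a = p → U a = p := by
    rintro U ⟨hU, hmax⟩ Y hY a ha
    by_contra hUa
    obtain ⟨Z, hZ, hle⟩ := hS U hU Y hY
    exact (hmax Z hZ).not_gt
      (voteCount_lt_voteCount (fun b hb => hle b (Or.inl hb)) hUa (hle a (Or.inr ha)))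
  obtain ⟨U, hU, hmax⟩ := Set.exists_max_image S (voteCount p) (Set.toFinite S) hne
  have hUf : U ∈ favouring p S := ⟨hU, hmax⟩
  refine ⟨U, hU, Set.eq_singleton_iff_unique_mem.2 ⟨hUf, fun V hV => funext fun a => ?_⟩, top U hUf⟩
  -- Two maximisers have the same `p`-voters, which determines an outcome in `Fin 2`.
  have h₁ := top U hUf V hV.1 a
  have h₂ := top V hV U hU a
  omega

theorem MergeStable.exists_least_greatest {N : Type*} [Fintype N] {B : Ballots N (Fin 2)}
    {cost : Certificate B → ℕ} (hcost : MergeStable cost) :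
    ∃ L U : N → Fin 2,
      favouring 0 (minOutcomes B cost) = {L} ∧ favouring 1 (minOutcomes B cost) = {U} ∧
      (∀ X ∈ minOutcomes B cost, L ≤ X ∧ X ≤ U) ∧
      IsLeast (minOutcomes B cost) L ∧ IsGreatest (minOutcomes B cost) U := by
  have hne := minOutcomes_nonempty cost
  obtain ⟨L, hL, hL0, hLle⟩ := exists_favouring_eq_singleton (p := 0) hne
    fun X hX Y hY => hcost.exists_minOutcomes 0 hX hY
  obtain ⟨U, hU, hU1, hUle⟩ := exists_favouring_eq_singleton (p := 1) hne
    fun X hX Y hY => hcost.exists_minOutcomes 1 hX hY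
  have lower : ∀ X ∈ minOutcomes B cost, L ≤ X := fun X hX a => by
    have := hLle X hX a
    change L a ≤ X a
    omega
  have upper : ∀ X ∈ minOutcomes B cost, X ≤ U := fun X hX a => by
    have := hUle X hX a
    change X a ≤ U a
    omega
  exact ⟨L, U, hL0, hU1, fun X hX => ⟨lower X hX, upper X hX⟩, ⟨hL, lower⟩, ⟨hU, upper⟩⟩

end LiquidDemocracy

theorem mainTheorem12 {N : Type*} [Fintype N] (B : LiquidDemocracy.Ballots N (Fin 2)) :
    (∃ L U : N → Fin 2,
      LiquidDemocracy.MinMaxBiased 0 B = {L} ∧ LiquidDemocracy.MinMaxBiased 1 B = {U} ∧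
      (∀ X ∈ LiquidDemocracy.MinMax B, L ≤ X ∧ X ≤ U) ∧
      IsLeast (LiquidDemocracy.MinMax B) L ∧ IsGreatest (LiquidDemocracy.MinMax B) U) ∧
    (∃ L U : N → Fin 2,
      LiquidDemocracy.MinSumBiased 0 B = {L} ∧ LiquidDemocracy.MinSumBiased 1 B = {U} ∧
      (∀ X ∈ LiquidDemocracy.MinSum B, L ≤ X ∧ X ≤ U) ∧
      IsLeast (LiquidDemocracy.MinSum B) L ∧ IsGreatest (LiquidDemocracy.MinSum B) U) := by
  -- `MinMax` and `MinSum` are definitionally `minOutcomes` for their costs.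
  exact ⟨LiquidDemocracy.mergeStable_maxCost.exists_least_greatest,
    LiquidDemocracy.mergeStable_sumCost.exists_least_greatest⟩
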